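/- Let $d_1,d_2$ be integers with $m=2d_1+1\ge 3$ and $n=2d_2+1\ge 3$, and let $|0\rangle,\dots,|m-1\rangle$ and $|0\rangle,\dots,|n-1\rangle$ be the computational bases of $\mathbb{C}^m$ (held by Alice) and $\mathbb{C}^n$ (held by Bob). Consider the following (unnormalized) vectors of $\mathbb{C}^m\otimes\mathbb{C}^n$, for all $\delta=0,1,\dots,d_2-1$, all $\sigma=0,1,\dots,d_1-1$ and both choices of the sign: $$|0\rangle\big(|2\delta\rangle\pm|2\delta+1\rangle\big),\qquad \big(|2\sigma\rangle\pm|2\sigma+1\rangle\big)|n-1\rangle,\qquad |m-1\rangle\big(|2\delta+1\rangle\pm|2\delta+2\rangle\big),\qquad \big(|2\sigma+1\rangle\pm|2\sigma+2\rangle\big)|0\rangle .$$ These are exactly $2(m+n)-4$ distinct, nonzero, pairwise orthogonal product states, and the set of these states cannot be perfectly distinguished by local operations and classical communication (LOCC): there is no LOCC protocol that identifies every state of the set with probability one. Here an LOCC protocol consists of steps in each of which one of the two parties applies a local quantum instrument with finitely many outcomes to its own system, chosen depending on all earlier outcomes, and announces the outcome; the protocol ends with a guess of the state. The number of steps may be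 finite, or infinite in the sense that the protocol is given by a sequence of finite protocols, each continuing the previous one, along which the probability of a correct guess tends to one for every state of the set. -/

import Mathlib

open scoped Matrix Kronecker

noncomputable section

namespace LOCC

/-- A local quantum instrument with finitely many classical outcomes on a party holding `ℂ^a`.
Outcome `i` acts by the completely positive map with Kraus operators `op i j`, and leaves the party
with `ℂ^(dim i)` (so attaching or discarding local ancillas is allowed). The maps sum to a
trace-preserving map. -/
structure Instrument (a : ℕ) where
  outcomes : ℕ
  dim : Fin outcomes → ℕ
  rank : Fin outcomes → ℕ
  op : (i : Fin outcomes) → Fin (rank i) → Matrix (Fin (dim i)) (Fin a) ℂ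
  complete : ∑ i, ∑ j, (op i j)ᴴ * op i j = 1

/-- Operators on `ℂ^a ⊗ ℂ^b`, in the computational product basis. -/
abbrev Operator (a b : ℕ) : Type := Matrix (Fin a × Fin b) (Fin a × Fin b) ℂ

/-- The unnormalized state after Alice applies `I` and obtains outcome `i`; its trace is the
probability of that outcome. -/
def Instrument.onAlice {a b : ℕ} (I : Instrument a) (i : Fin I.outcomes) (ρ : Operator a b) :
    Operator (I.dim i) b :=
  ∑ j, (I.op i j ⊗ₖ (1 : Matrix (Fin b) (Fin b) ℂ)) * ρ *
    (I.op i j ⊗ₖ (1 : Matrix (Fin b) (Fin b) ℂ))ᴴ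

/-- The unnormalized state after Bob applies `I` and obtains outcome `i`. -/
def Instrument.onBob {a b : ℕ} (I : Instrument b) (i : Fin I.outcomes) (ρ : Operator a b) :
    Operator a (I.dim i) :=
  ∑ j, ((1 : Matrix (Fin a) (Fin a) ℂ) ⊗ₖ I.op i j) * ρ *
    ((1 : Matrix (Fin a) (Fin a) ℂ) ⊗ₖ I.op i j)ᴴ

/-- Finite-round LOCC protocols on `ℂ^a ⊗ ℂ^b` that end with a guess in `S`. In each step one party
applies a local instrument and broadcasts the outcome, on which everything that follows may
depend. -/
inductive Protocol (S : Type) : ℕ → ℕ → Type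
  | guess {a b : ℕ} (s : S) : Protocol S a b
  | alice {a b : ℕ} (I : Instrument a) (next : (i : Fin I.outcomes) → Protocol S (I.dim i) b) :
      Protocol S a b
  | bob {a b : ℕ} (I : Instrument b) (next : (i : Fin I.outcomes) → Protocol S a (I.dim i)) :
      Protocol S a b

open Classical in
/-- The probability that the protocol, run on the state `ρ`, ends with the guess `s`. -/
def Protocol.prob {S : Type} : {a b : ℕ} → Protocol S a b → Operator a b → S → ℝ
  | _, _, .guess t, ρ, s => if t = s then ρ.trace.re else 0
  | _, _, .alice I next, ρ, s => ∑ i, (next i).prob (I.onAlice i ρ) s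
  | _, _, .bob I next, ρ, s => ∑ i, (next i).prob (I.onBob i ρ) s

/-- `P.Extends Q`: the protocol `Q` performs all the steps of `P` and may then, instead of making
the guess that `P` makes, go on with further steps. -/
inductive Protocol.Extends {S : Type} : {a b : ℕ} → Protocol S a b → Protocol S a b → Prop
  | guess {a b : ℕ} (s : S) (Q : Protocol S a b) : Protocol.Extends (.guess s) Q
  | alice {a b : ℕ} (I : Instrument a) (P Q : (i : Fin I.outcomes) → Protocol S (I.dim i) b)
      (h : ∀ i, Protocol.Extends (P i) (Q i)) : Protocol.Extends (.alice I P) (.alice I Q)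
  | bob {a b : ℕ} (I : Instrument b) (P Q : (i : Fin I.outcomes) → Protocol S a (I.dim i))
      (h : ∀ i, Protocol.Extends (P i) (Q i)) : Protocol.Extends (.bob I P) (.bob I Q)

/-- Every protocol extends itself. -/
theorem Protocol.Extends.refl {S : Type} {a b : ℕ} (P : Protocol S a b) : P.Extends P := by
  induction P with
  | guess s => exact .guess s _
  | alice I next ih => exact .alice I _ _ ih
  | bob I next ih => exact .bob I _ _ ih

/-- Vectors of `ℂ^a ⊗ ℂ^b`, in the computational product basis. -/
abbrev Vec (a b : ℕ) : Type := Fin a × Fin b → ℂ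

/-- The density operator `|v⟩⟨v| / ⟨v|v⟩` of the pure state given by the (not necessarily
normalized) nonzero vector `v`. -/
def density {a b : ℕ} (v : Vec a b) : Operator a b :=
  (star v ⬝ᵥ v)⁻¹ • Matrix.vecMulVec v (star v)

/-- A set of pure states is perfectly distinguished by LOCC if some LOCC protocol, given any state
of the set, identifies it with probability one. Protocols with infinitely many rounds are allowed:
such a protocol is given by its finite stages `P 0, P 1, …`, each going on from the previous one,
and identifies `v` with probability one if the probability of guessing `v` tends to one. A
finite-round protocol is the special case of a constant sequence, for which the probability has to
equal one (see the next theorem). -/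
def PerfectlyDistinguishable {a b : ℕ} (V : Set (Vec a b)) : Prop :=
  ∃ P : ℕ → Protocol V a b, (∀ r, (P r).Extends (P (r + 1))) ∧
    ∀ v : V, Filter.Tendsto (fun r => (P r).prob (density v.1) v) Filter.atTop (nhds 1)

/-- Perfect discrimination by a finite-round LOCC protocol is a special case. -/
theorem PerfectlyDistinguishable.of_finite {a b : ℕ} {V : Set (Vec a b)} (P : Protocol V a b)
    (h : ∀ v : V, P.prob (density v.1) v = 1) : PerfectlyDistinguishable V :=
  ⟨fun _ => P, fun _ => .refl P, fun v => by simp [h v]⟩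

/-- The product vector `|x⟩|y⟩`. -/
def tensor {a b : ℕ} (x : Fin a → ℂ) (y : Fin b → ℂ) : Vec a b := fun p => x p.1 * y p.2

/-- The computational basis vector `|i⟩` of `ℂ^a`, for `0 ≤ i < a`. -/
def ket (a i : ℕ) : Fin a → ℂ := fun k => if (k : ℕ) = i then 1 else 0

/-- A set of (unnormalized, pairwise orthogonal) orthogonal product states. -/
def IsOPS {a b : ℕ} (V : Set (Vec a b)) : Prop :=
  (∀ v ∈ V, v ≠ 0 ∧ ∃ x y, v = tensor x y) ∧ V.Pairwise fun v w => star v ⬝ᵥ w = 0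

/-- The states `|0⟩(|2δ⟩ ± |2δ+1⟩)`, `(|2σ⟩ ± |2σ+1⟩)|n-1⟩`, `|m-1⟩(|2δ+1⟩ ± |2δ+2⟩)` and
`(|2σ+1⟩ ± |2σ+2⟩)|0⟩` of `ℂ^m ⊗ ℂ^n`, with `0 ≤ δ < d₂` and `0 ≤ σ < d₁`. -/
def states (m n d₁ d₂ : ℕ) : Set (Vec m n) :=
  {v | ∃ δ < d₂,
      v = tensor (ket m 0) (ket n (2 * δ) + ket n (2 * δ + 1)) ∨
      v = tensor (ket m 0) (ket n (2 * δ) - ket n (2 * δ + 1))} ∪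
  {v | ∃ σ < d₁,
      v = tensor (ket m (2 * σ) + ket m (2 * σ + 1)) (ket n (n - 1)) ∨
      v = tensor (ket m (2 * σ) - ket m (2 * σ + 1)) (ket n (n - 1))} ∪
  {v | ∃ δ < d₂,
      v = tensor (ket m (m - 1)) (ket n (2 * δ + 1) + ket n (2 * δ + 2)) ∨
      v = tensor (ket m (m - 1)) (ket n (2 * δ + 1) - ket n (2 * δ + 2))} ∪
  {v | ∃ σ < d₁,
      v = tensor (ket m (2 * σ + 1) + ket m (2 * σ + 2)) (ket n 0) ∨
      v = tensor (ket m (2 * σ + 1) - ket m (2 * σ + 2)) (ket n 0)}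

end LOCC

end

open scoped Matrix Kronecker
open scoped ComplexOrder

namespace LOCC

/-! The argument is an error bound that is uniform over all finite protocols. In the Heisenberg
picture a protocol splits `1 ⊗ 1` along a tree of product operators `A ⊗ B`, each step decomposing
one factor into positive summands, and each leaf being assigned to a guess (`Splits`,
`Protocol.exists_splits`). Call a factor balanced if no diagonal entry is below a fixed fraction `c`
of its trace. The root is balanced on both sides.

Follow a branch while both factors stay balanced. If it reaches a leaf in this way, some pair of
states excludes the guess, and both of its states are wrongly identified with a weight comparable to
`tr A · tr B`. Otherwise one factor loses balance while the other, untouched in that step, is still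
balanced. Then two consecutive diagonal entries of the unbalanced factor differ noticeably
(`exists_consecutive_gap`). The pair `(|i⟩ ± |i+1⟩)|k⟩` or `|k⟩(|i⟩ ± |i+1⟩)` linking them is no
longer nearly orthogonal under `A ⊗ B`, so by Cauchy–Schwarz it cannot be told apart with small
error (`reForm_sq_le_errorWeight`). In both cases the error is at least a constant times `tr A · tr
B`. These weights add up over the tree, so the total error is at least a positive constant times `m
n`, which rules out a limit of zero.

The states enter only through their pairs, which link all consecutive basis vectors of each party.
Orthogonality and the count come from the dominoes being a pinwheel tiling of the boundary of the `m
× n` grid. -/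

/-! ### Sesquilinear forms of product operators. -/

/-- The real part of the sesquilinear form `⟨x|M|y⟩`. -/
def reForm {ι : Type*} [Fintype ι] (M : Matrix ι ι ℂ) (x y : ι → ℂ) : ℝ :=
  (star x ⬝ᵥ M *ᵥ y).re

theorem reForm_sum {ι κ : Type*} [Fintype ι] (s : Finset κ) (M : κ → Matrix ι ι ℂ) (x y : ι → ℂ) :
    reForm (∑ k ∈ s, M k) x y = ∑ k ∈ s, reForm (M k) x y := by
  simp [reForm, Matrix.sum_mulVec, dotProduct_sum, Complex.re_sum]

theorem reForm_self_nonneg {ι : Type*} [Fintype ι] {M : Matrix ι ι ℂ} (hM : M.PosSemidef)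
    (x : ι → ℂ) : 0 ≤ reForm M x x :=
  hM.re_dotProduct_nonneg x

theorem reForm_comm {ι : Type*} [Fintype ι] {M : Matrix ι ι ℂ} (hM : M.IsHermitian)
    (x y : ι → ℂ) : reForm M y x = reForm M x y := by
  have h : star (star y ⬝ᵥ M *ᵥ x) = star x ⬝ᵥ M *ᵥ y := by
    rw [Matrix.star_dotProduct, star_star, Matrix.star_mulVec, hM.eq, ← Matrix.dotProduct_mulVec]
  rw [reForm, reForm, ← h]
  simp

/-- Cauchy–Schwarz, from the discriminant of the nonnegative real quadratic `t ↦ ⟨x + t y|M|x + t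
y⟩`. -/
theorem reForm_sq_le {ι : Type*} [Fintype ι] {M : Matrix ι ι ℂ} (hM : M.PosSemidef)
    (x y : ι → ℂ) : reForm M x y ^ 2 ≤ reForm M x x * reForm M y y := by
  have key : ∀ t : ℝ, 0 ≤ reForm M y y * (t * t) + 2 * reForm M x y * t + reForm M x x := by
    intro t
    have h := reForm_self_nonneg hM (x + (t : ℂ) • y)
    have e : reForm M (x + (t : ℂ) • y) (x + (t : ℂ) • y)
        = reForm M x x + t * reForm M x y + t * reForm M y x + t * t * reForm M y y := by
      simp [reForm, Matrix.mulVec_add, Matrix.mulVec_smul]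
      ring
    rw [e, reForm_comm hM.isHermitian x y] at h
    linarith
  have := discrim_le_zero key
  rw [discrim] at this
  nlinarith

theorem tensor_dotProduct {a b : ℕ} (x x' : Fin a → ℂ) (y y' : Fin b → ℂ) :
    tensor x y ⬝ᵥ tensor x' y' = (x ⬝ᵥ x') * (y ⬝ᵥ y') := by
  simp only [dotProduct, tensor, Fintype.sum_prod_type, Finset.sum_mul_sum]
  exact Finset.sum_congr rfl fun i _ => Finset.sum_congr rfl fun j _ => by ring

theorem star_tensor {a b : ℕ} (x : Fin a → ℂ) (y : Fin b → ℂ) :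
    star (tensor x y) = tensor (star x) (star y) := by
  ext p
  simp [tensor]

theorem kronecker_mulVec_tensor {a b : ℕ} (A : Matrix (Fin a) (Fin a) ℂ)
    (B : Matrix (Fin b) (Fin b) ℂ) (x : Fin a → ℂ) (y : Fin b → ℂ) :
    (A ⊗ₖ B) *ᵥ tensor x y = tensor (A *ᵥ x) (B *ᵥ y) := by
  ext p
  exact tensor_dotProduct (A p.1) x (B p.2) y

theorem reForm_kronecker {a b : ℕ} (A : Matrix (Fin a) (Fin a) ℂ) (B : Matrix (Fin b) (Fin b) ℂ)
    (x x' : Fin a → ℂ) (y y' : Fin b → ℂ) :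
    reForm (A ⊗ₖ B) (tensor x y) (tensor x' y') =
      ((star x ⬝ᵥ A *ᵥ x') * (star y ⬝ᵥ B *ᵥ y')).re := by
  rw [reForm, kronecker_mulVec_tensor, star_tensor, tensor_dotProduct]

/-- The real parts of the diagonal entries of a matrix. -/
def reDiag {a : ℕ} (A : Matrix (Fin a) (Fin a) ℂ) (i : Fin a) : ℝ := (A i i).re

theorem reDiag_nonneg {a : ℕ} {A : Matrix (Fin a) (Fin a) ℂ} (hA : A.PosSemidef) (i : Fin a) :
    0 ≤ reDiag A i := (Complex.nonneg_iff.mp (hA.diag_nonneg (i := i))).1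

theorem reDiag_sum {a : ℕ} {κ : Type*} (s : Finset κ) (A : κ → Matrix (Fin a) (Fin a) ℂ)
    (i : Fin a) : reDiag (∑ k ∈ s, A k) i = ∑ k ∈ s, reDiag (A k) i := by
  simp [reDiag, Matrix.sum_apply, Complex.re_sum]

theorem ket_eq_single {a : ℕ} (i : Fin a) : ket a i = Pi.single i 1 := by
  ext k
  simp [ket, Pi.single_apply, Fin.ext_iff]

theorem im_diag_eq_zero {a : ℕ} {A : Matrix (Fin a) (Fin a) ℂ} (hA : A.PosSemidef) (i : Fin a) :
    (A i i).im = 0 := (Complex.nonneg_iff.mp (hA.diag_nonneg (i := i))).2.symm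

/-! ### Forms evaluated on pairs of states with opposite signs. -/

section Domino

variable {a b : ℕ} {A : Matrix (Fin a) (Fin a) ℂ} {B : Matrix (Fin b) (Fin b) ℂ}

theorem star_ket_dotProduct (A : Matrix (Fin a) (Fin a) ℂ) (i j : Fin a) :
    star (ket a i) ⬝ᵥ A *ᵥ ket a j = A i j := by
  have : star (Pi.single i (1:ℂ)) = (Pi.single i (1:ℂ) : Fin a → ℂ) := by
    ext k
    by_cases h : k = i <;> simp [h]
  simp [ket_eq_single, this]

/-- The off-diagonal contribution `A j i - A i j` is purely imaginary for Hermitian `A`, and `B k k`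
is real. Taking real parts thus leaves only diagonal entries, which is why the whole proof works
with `reForm`. -/
theorem reForm_horizontal_plus_minus (hA : A.IsHermitian) (hB : B.PosSemidef) (i j : Fin a)
    (k : Fin b) :
    reForm (A ⊗ₖ B) (tensor (ket a i + ket a j) (ket b k)) (tensor (ket a i - ket a j) (ket b k))
      = (reDiag A i - reDiag A j) * reDiag B k := by
  have h : A j i = star (A i j) := (hA.apply j i).symm
  rw [reForm_kronecker]
  simp only [star_add, Matrix.mulVec_sub, add_dotProduct, dotProduct_sub, star_ket_dotProduct, h]
  simp [reDiag, im_diag_eq_zero hB]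
  left
  ring

theorem reForm_vertical_plus_minus (hA : A.PosSemidef) (hB : B.IsHermitian) (k : Fin a)
    (i j : Fin b) :
    reForm (A ⊗ₖ B) (tensor (ket a k) (ket b i + ket b j)) (tensor (ket a k) (ket b i - ket b j))
      = (reDiag B i - reDiag B j) * reDiag A k := by
  have h : B j i = star (B i j) := (hB.apply j i).symm
  rw [reForm_kronecker]
  simp only [star_add, Matrix.mulVec_sub, add_dotProduct, dotProduct_sub, star_ket_dotProduct, h]
  simp [reDiag, im_diag_eq_zero hA, mul_comm]
  left
  ring

theorem reForm_horizontal_add (hA : A.IsHermitian) (hB : B.PosSemidef) (i j : Fin a) (k : Fin b) :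
    reForm (A ⊗ₖ B) (tensor (ket a i + ket a j) (ket b k)) (tensor (ket a i + ket a j) (ket b k)) +
      reForm (A ⊗ₖ B) (tensor (ket a i - ket a j) (ket b k)) (tensor (ket a i - ket a j) (ket b k))
      = 2 * (reDiag A i + reDiag A j) * reDiag B k := by
  have h : A j i = star (A i j) := (hA.apply j i).symm
  simp only [reForm_kronecker, star_add, star_sub, Matrix.mulVec_sub, Matrix.mulVec_add,
    add_dotProduct, sub_dotProduct, dotProduct_add, dotProduct_sub, star_ket_dotProduct, h]
  simp [reDiag, im_diag_eq_zero hB]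
  ring

theorem reForm_vertical_add (hA : A.PosSemidef) (hB : B.IsHermitian) (k : Fin a) (i j : Fin b) :
    reForm (A ⊗ₖ B) (tensor (ket a k) (ket b i + ket b j)) (tensor (ket a k) (ket b i + ket b j)) +
      reForm (A ⊗ₖ B) (tensor (ket a k) (ket b i - ket b j)) (tensor (ket a k) (ket b i - ket b j))
      = 2 * (reDiag B i + reDiag B j) * reDiag A k := by
  have h : B j i = star (B i j) := (hB.apply j i).symm
  simp only [reForm_kronecker, star_add, star_sub, Matrix.mulVec_sub, Matrix.mulVec_add,
    add_dotProduct, sub_dotProduct, dotProduct_add, dotProduct_sub, star_ket_dotProduct, h]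
  simp [reDiag, im_diag_eq_zero hA]
  ring

end Domino

/-! ### Diagonal gaps and traces. -/

/-- If a nonnegative vector has an entry below the fraction `c` of its total, some two
consecutive entries differ by at least the fraction `η` of the total. -/
theorem exists_consecutive_gap {a : ℕ} {f : Fin a → ℝ} {c η : ℝ} (hη : 0 ≤ η)
    (h : a * c + a ^ 2 * η < 1) (hf : ∀ i, 0 ≤ f i) {i₀ : Fin a} (hi₀ : f i₀ < c * ∑ i, f i) :
    ∃ i j : Fin a, (j : ℕ) = i + 1 ∧ η * ∑ i, f i ≤ |f i - f j| := by
  by_contra! hcon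
  set T := ∑ i, f i with hT
  have hT0 : 0 ≤ T := Finset.sum_nonneg fun i _ => hf i
  have up : ∀ (d : ℕ) (i j : Fin a), (j : ℕ) = i + d → |f i - f j| ≤ d * (η * T) := by
    intro d
    induction d with
    | zero => intro i j hij; obtain rfl : j = i := Fin.ext hij; simp
    | succ d ih =>
      intro i j hij
      have h1 := ih i ⟨i + d, by omega⟩ rfl
      have h2 := hcon ⟨i + d, by omega⟩ j (by simp [hij]; omega)
      have h3 := abs_sub_le (f i) (f ⟨i + d, by omega⟩) (f j)
      push_cast
      linarith
  have all : ∀ i j : Fin a, |f i - f j| ≤ a * (η * T) := by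
    have main : ∀ i j : Fin a, (i : ℕ) ≤ j → |f i - f j| ≤ a * (η * T) := by
      intro i j hij
      refine (up (j - i) i j (by omega)).trans ?_
      have : ((j - i : ℕ) : ℝ) ≤ a := by exact_mod_cast (by omega)
      exact mul_le_mul_of_nonneg_right this (by positivity)
    intro i j
    rcases le_total (i : ℕ) j with hij | hij
    · exact main i j hij
    · rw [abs_sub_comm]; exact main j i hij
  -- Without a large gap, all `a` entries lie within `a η T` of `f i₀ < c T`. As `a c + a² η < 1`,
  -- this contradicts `T > 0`.
  have hsum : T ≤ a * (c * T + a * (η * T)) := by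
    calc T = ∑ i, f i := hT
      _ ≤ ∑ _i : Fin a, (c * T + a * (η * T)) := by
        refine Finset.sum_le_sum fun i _ => ?_
        have := (abs_le.mp (all i i₀)).2
        linarith
      _ = _ := by simp [mul_add]
  have hTpos : 0 < T := by
    rcases hT0.eq_or_lt with h0 | h0
    · rw [← h0] at hi₀; have := hf i₀; simp at hi₀; linarith
    · exact h0
  nlinarith

/-- The sum of the real parts of the diagonal entries. -/
def weight {a : ℕ} (A : Matrix (Fin a) (Fin a) ℂ) : ℝ := ∑ i, reDiag A i

theorem weight_nonneg {a : ℕ} {A : Matrix (Fin a) (Fin a) ℂ} (hA : A.PosSemidef) : 0 ≤ weight A :=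
  Finset.sum_nonneg fun i _ => reDiag_nonneg hA i

theorem weight_sum {a k : ℕ} (A : Fin k → Matrix (Fin a) (Fin a) ℂ) :
    weight (∑ i, A i) = ∑ i, weight (A i) := by
  simp only [weight, reDiag_sum]
  exact Finset.sum_comm

theorem reDiag_le_weight {a : ℕ} {A : Matrix (Fin a) (Fin a) ℂ} (hA : A.PosSemidef) (i : Fin a) :
    reDiag A i ≤ weight A :=
  Finset.single_le_sum (fun j _ => reDiag_nonneg hA j) (Finset.mem_univ i)

/-! ### Splitting product operators along a protocol tree. -/

open Classical in
/-- `Splits A B E`: the product operator `A ⊗ B` is split by LOCC into the operators `E s`, where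
`E s` belongs to the final guess `s`. -/
inductive Splits {S : Type} {a b : ℕ} :
    Matrix (Fin a) (Fin a) ℂ → Matrix (Fin b) (Fin b) ℂ → (S → Operator a b) → Prop
  | guess (A : Matrix (Fin a) (Fin a) ℂ) (B : Matrix (Fin b) (Fin b) ℂ) (hA : A.PosSemidef)
      (hB : B.PosSemidef) (s : S) : Splits A B (fun t => if t = s then A ⊗ₖ B else 0)
  | alice {k : ℕ} (A : Fin k → Matrix (Fin a) (Fin a) ℂ) (B : Matrix (Fin b) (Fin b) ℂ)
      (hB : B.PosSemidef) (E : Fin k → S → Operator a b) (h : ∀ i, Splits (A i) B (E i)) :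
      Splits (∑ i, A i) B (fun s => ∑ i, E i s)
  | bob {k : ℕ} (A : Matrix (Fin a) (Fin a) ℂ) (B : Fin k → Matrix (Fin b) (Fin b) ℂ)
      (hA : A.PosSemidef) (E : Fin k → S → Operator a b) (h : ∀ i, Splits A (B i) (E i)) :
      Splits A (∑ i, B i) (fun s => ∑ i, E i s)

namespace Splits

variable {S : Type} {a b : ℕ} {A : Matrix (Fin a) (Fin a) ℂ} {B : Matrix (Fin b) (Fin b) ℂ}
  {E : S → Operator a b}

theorem posSemidef (h : Splits A B E) :
    A.PosSemidef ∧ B.PosSemidef ∧ ∀ s, (E s).PosSemidef := by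
  induction h with
  | guess A B hA hB s =>
    refine ⟨hA, hB, fun t => ?_⟩
    dsimp only
    split_ifs
    · exact hA.kronecker hB
    · exact .zero
  | alice A B hB E h ih =>
    exact ⟨Matrix.posSemidef_sum _ fun i _ => (ih i).1, hB,
      fun s => Matrix.posSemidef_sum _ fun i _ => (ih i).2.2 s⟩
  | bob A B hA E h ih =>
    exact ⟨hA, Matrix.posSemidef_sum _ fun i _ => (ih i).2.1,
      fun s => Matrix.posSemidef_sum _ fun i _ => (ih i).2.2 s⟩

theorem sum_kronecker {k : ℕ} (A : Fin k → Matrix (Fin a) (Fin a) ℂ)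
    (B : Matrix (Fin b) (Fin b) ℂ) : (∑ i, A i) ⊗ₖ B = ∑ i, A i ⊗ₖ B := by
  ext p q
  simp [Matrix.sum_apply, Finset.sum_mul]

theorem kronecker_sum {k : ℕ} (A : Matrix (Fin a) (Fin a) ℂ)
    (B : Fin k → Matrix (Fin b) (Fin b) ℂ) : A ⊗ₖ (∑ i, B i) = ∑ i, A ⊗ₖ B i := by
  ext p q
  simp [Matrix.sum_apply, Finset.mul_sum]

/-- The sum does not depend on how the tree continues below a node, so a defect of `A ⊗ B` bounds
the error of every continuation. -/
theorem sum_eq [Fintype S] (h : Splits A B E) : ∑ s, E s = A ⊗ₖ B := by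
  induction h with
  | guess A B hA hB s =>
    classical
    exact (Finset.sum_ite_eq' _ s fun _ => A ⊗ₖ B).trans (if_pos (Finset.mem_univ s))
  | alice A B hB E h ih =>
    rw [Finset.sum_comm, sum_kronecker]
    exact Finset.sum_congr rfl fun i _ => ih i
  | bob A B hA E h ih =>
    rw [Finset.sum_comm, kronecker_sum]
    exact Finset.sum_congr rfl fun i _ => ih i

end Splits

/-! ### Error weight and near-orthogonality. -/

open Classical in
/-- The total unnormalized probability of a wrong guess, summed over the vectors `v t`, when the
guess `s` is made with the operator `E s`. -/
noncomputable def errorWeight {S : Type} [Fintype S] {a b : ℕ} (v : S → Vec a b)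
    (E : S → Operator a b) : ℝ :=
  ∑ t, ∑ s, if s = t then 0 else reForm (E s) (v t) (v t)

section Error

variable {S : Type} [Fintype S] {a b : ℕ} {v : S → Vec a b} {E : S → Operator a b}

theorem reForm_le_errorWeight (hE : ∀ s, (E s).PosSemidef) {s t : S} (hst : s ≠ t) :
    reForm (E s) (v t) (v t) ≤ errorWeight v E := by
  classical
  have nn : ∀ t s : S, 0 ≤ if s = t then 0 else reForm (E s) (v t) (v t) := by
    intro t s
    split_ifs
    · exact le_rfl
    · exact reForm_self_nonneg (hE s) _
  calc reForm (E s) (v t) (v t) = if s = t then 0 else reForm (E s) (v t) (v t) := by simp [hst]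
    _ ≤ ∑ s, if s = t then 0 else reForm (E s) (v t) (v t) :=
      Finset.single_le_sum (f := fun s => if s = t then 0 else reForm (E s) (v t) (v t))
        (fun s _ => nn t s) (Finset.mem_univ s)
    _ ≤ errorWeight v E := by
      unfold errorWeight
      convert Finset.single_le_sum
        (f := fun t => ∑ s, if s = t then 0 else reForm (E s) (v t) (v t))
        (fun t _ => Finset.sum_nonneg fun s _ => nn t s) (Finset.mem_univ t)

theorem errorWeight_nonneg (hE : ∀ s, (E s).PosSemidef) : 0 ≤ errorWeight v E := by
  classical
  refine Finset.sum_nonneg fun t _ => Finset.sum_nonneg fun s _ => ?_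
  split_ifs
  · exact le_rfl
  · exact reForm_self_nonneg (hE s) _

theorem errorWeight_sum {k : ℕ} (E : Fin k → S → Operator a b) :
    errorWeight v (fun s => ∑ i, E i s) = ∑ i, errorWeight v (E i) := by
  classical
  simp only [errorWeight, reForm_sum]
  rw [Finset.sum_comm (s := (Finset.univ : Finset (Fin k)))]
  refine Finset.sum_congr rfl fun t _ => ?_
  rw [Finset.sum_comm (s := (Finset.univ : Finset (Fin k)))]
  refine Finset.sum_congr rfl fun s _ => ?_
  split_ifs <;> simp

/-- This form, total minus correct guesses, connects the error to the success probabilities in the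
limit argument. -/
theorem errorWeight_eq (v : S → Vec a b) (E : S → Operator a b) :
    errorWeight v E = ∑ t, (reForm (∑ s, E s) (v t) (v t) - reForm (E t) (v t) (v t)) := by
  classical
  refine Finset.sum_congr rfl fun t _ => ?_
  rw [reForm_sum, ← Finset.add_sum_erase _ _ (Finset.mem_univ t), if_pos rfl, zero_add,
    ← Finset.add_sum_erase (a := t) _ (fun s => reForm (E s) (v t) (v t)) (Finset.mem_univ t),
    add_sub_cancel_left]
  exact Finset.sum_congr rfl fun s hs => if_neg (Finset.ne_of_mem_erase hs)

/-- Vectors that are identified with a small error stay nearly orthogonal. -/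
theorem reForm_sq_le_errorWeight (hE : ∀ s, (E s).PosSemidef) {s t : S} (hst : s ≠ t) {K : ℝ}
    (hs : reForm (∑ r, E r) (v s) (v s) ≤ K) (ht : reForm (∑ r, E r) (v t) (v t) ≤ K) :
    reForm (∑ r, E r) (v s) (v t) ^ 2 ≤ Fintype.card S ^ 2 * (K * errorWeight v E) := by
  have hK : ∀ u : S, reForm (∑ r, E r) (v u) (v u) ≤ K → ∀ r, reForm (E r) (v u) (v u) ≤ K := by
    intro u hu r
    refine le_trans ?_ hu
    rw [reForm_sum]
    exact Finset.single_le_sum (f := fun r => reForm (E r) (v u) (v u))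
      (fun r _ => reForm_self_nonneg (hE r) _) (Finset.mem_univ r)
  have herr := errorWeight_nonneg (v := v) hE
  have hK0 : 0 ≤ K := (reForm_self_nonneg (hE s) _).trans (hK s hs s)
  -- No guess `r` is right for both `s` and `t`. In the Cauchy–Schwarz bound, one factor is
  -- therefore an error term, and the other is at most `K`.
  have term : ∀ r, |reForm (E r) (v s) (v t)| ≤ √(K * errorWeight v E) := by
    intro r
    refine Real.abs_le_sqrt ((reForm_sq_le (hE r) _ _).trans ?_)
    by_cases hr : r = s
    · subst hr
      exact mul_le_mul (hK _ hs _) (reForm_le_errorWeight hE hst) (reForm_self_nonneg (hE _) _) hK0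
    · rw [mul_comm]
      exact mul_le_mul (hK _ ht _) (reForm_le_errorWeight hE hr) (reForm_self_nonneg (hE _) _) hK0
  have tot : |reForm (∑ r, E r) (v s) (v t)| ≤ Fintype.card S * √(K * errorWeight v E) := by
    rw [reForm_sum]
    refine (Finset.abs_sum_le_sum_abs _ _).trans ((Finset.sum_le_sum fun r _ => term r).trans ?_)
    simp
  calc reForm (∑ r, E r) (v s) (v t) ^ 2 = |reForm (∑ r, E r) (v s) (v t)| ^ 2 := (sq_abs _).symm
    _ ≤ (Fintype.card S * √(K * errorWeight v E)) ^ 2 := by gcongr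
    _ = _ := by rw [mul_pow, Real.sq_sqrt (by positivity)]

end Error

/-! ### Lower bound on the error, by loss of balance. -/

/-- `v s` and `v t` are the horizontal pair `(|i⟩ ± |j⟩)|k⟩`. -/
def IsHorizontalPair {S : Type} {a b : ℕ} (v : S → Vec a b) (i j : Fin a) (k : Fin b) (s t : S) :
    Prop :=
  s ≠ t ∧ v s = tensor (ket a i + ket a j) (ket b k) ∧ v t = tensor (ket a i - ket a j) (ket b k)

/-- `v s` and `v t` are the vertical pair `|k⟩(|i⟩ ± |j⟩)`. -/
def IsVerticalPair {S : Type} {a b : ℕ} (v : S → Vec a b) (k : Fin a) (i j : Fin b) (s t : S) :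
    Prop :=
  s ≠ t ∧ v s = tensor (ket a k) (ket b i + ket b j) ∧ v t = tensor (ket a k) (ket b i - ket b j)

/-- Every diagonal entry is at least the fraction `c` of the trace. -/
def Balanced {a : ℕ} (c : ℝ) (A : Matrix (Fin a) (Fin a) ℂ) : Prop :=
  ∀ i, c * weight A ≤ reDiag A i

section Bound

variable {S : Type} [Fintype S] {a b : ℕ} {v : S → Vec a b} {E : S → Operator a b}
  {A : Matrix (Fin a) (Fin a) ℂ} {B : Matrix (Fin b) (Fin b) ℂ} {c η : ℝ}

/-- Here `D` plays the form between the two states of a pair, `N` the number of guesses, `τ` the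
product of the traces and `e` the error. Both bounds on `D` are quadratic in scale, so one factor
`τ` cancels. -/
theorem le_of_gap {N c η τ e D : ℝ} (hN : 0 < N) (hc : 0 ≤ c) (hη : 0 ≤ η) (hτ : 0 ≤ τ)
    (he : 0 ≤ e) (hD : η * c * τ ≤ |D|) (h : D ^ 2 ≤ N ^ 2 * (4 * τ * e)) :
    (c ^ 2 * η ^ 2) / (4 * N ^ 2) * τ ≤ e := by
  rcases hτ.eq_or_lt with rfl | hτ
  · simpa using he
  have h1 : (η * c * τ) ^ 2 ≤ D ^ 2 := by
    rw [← sq_abs D]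
    gcongr
  rw [div_mul_eq_mul_div, div_le_iff₀ (by positivity)]
  refine le_of_mul_le_mul_right ?_ hτ
  nlinarith

/-- If Alice's operator is not balanced but Bob's is, the error is not small. -/
theorem Splits.le_errorWeight_of_not_balanced_left (h : Splits A B E) (hc : 0 ≤ c) (hη : 0 ≤ η)
    (hcη : a * c + a ^ 2 * η < 1)
    (hv : ∀ i j : Fin a, (j : ℕ) = i + 1 → ∃ k s t, IsHorizontalPair v i j k s t)
    (hA' : ¬ Balanced c A) (hB' : Balanced c B) :
    (c ^ 2 * η ^ 2) / (4 * (Fintype.card S : ℝ) ^ 2) * (weight A * weight B) ≤ errorWeight v E := by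
  obtain ⟨hA, hB, hE⟩ := h.posSemidef
  obtain ⟨i₀, hi₀⟩ := not_forall.mp hA'
  obtain ⟨i, j, hij, hgap⟩ :=
    exists_consecutive_gap hη hcη (fun i => reDiag_nonneg hA i) (not_le.mp hi₀)
  obtain ⟨k, s, t, hst, hs, ht⟩ := hv i j hij
  have hadd := reForm_horizontal_add hA.isHermitian hB i j k
  have hpm := reForm_horizontal_plus_minus hA.isHermitian hB i j k
  -- The left side is the sum of the forms at the two states of the pair. Hence each of them is at
  -- most `K = 4 * (weight A * weight B)`.
  have hK : 2 * (reDiag A i + reDiag A j) * reDiag B k ≤ 4 * (weight A * weight B) := by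
    have h1 := mul_le_mul (reDiag_le_weight hA i) (reDiag_le_weight hB k) (reDiag_nonneg hB k)
      (weight_nonneg hA)
    have h2 := mul_le_mul (reDiag_le_weight hA j) (reDiag_le_weight hB k) (reDiag_nonneg hB k)
      (weight_nonneg hA)
    linarith
  rw [← hs, ← ht, ← h.sum_eq] at hadd hpm
  have hM : (∑ r, E r).PosSemidef := Matrix.posSemidef_sum _ fun r _ => hE r
  have h1 := reForm_self_nonneg hM (v s)
  have h2 := reForm_self_nonneg hM (v t)
  have : Nonempty S := ⟨s⟩
  refine le_of_gap (by exact_mod_cast Fintype.card_pos) hc hη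
    (mul_nonneg (weight_nonneg hA) (weight_nonneg hB)) (errorWeight_nonneg hE) ?_
    (reForm_sq_le_errorWeight hE hst (by linarith) (by linarith))
  rw [hpm, abs_mul, abs_of_nonneg (reDiag_nonneg hB k)]
  calc η * c * (weight A * weight B) = (η * weight A) * (c * weight B) := by ring
    _ ≤ _ := mul_le_mul hgap (hB' k) (mul_nonneg hc (weight_nonneg hB)) (abs_nonneg _)

/-- If Bob's operator is not balanced but Alice's is, the error is not small. -/
theorem Splits.le_errorWeight_of_not_balanced_right (h : Splits A B E) (hc : 0 ≤ c) (hη : 0 ≤ η)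
    (hcη : b * c + b ^ 2 * η < 1)
    (hv : ∀ i j : Fin b, (j : ℕ) = i + 1 → ∃ k s t, IsVerticalPair v k i j s t)
    (hA' : Balanced c A) (hB' : ¬ Balanced c B) :
    (c ^ 2 * η ^ 2) / (4 * (Fintype.card S : ℝ) ^ 2) * (weight A * weight B) ≤ errorWeight v E := by
  obtain ⟨hA, hB, hE⟩ := h.posSemidef
  obtain ⟨i₀, hi₀⟩ := not_forall.mp hB'
  obtain ⟨i, j, hij, hgap⟩ :=
    exists_consecutive_gap hη hcη (fun i => reDiag_nonneg hB i) (not_le.mp hi₀)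
  obtain ⟨k, s, t, hst, hs, ht⟩ := hv i j hij
  have hadd := reForm_vertical_add hA hB.isHermitian k i j
  have hpm := reForm_vertical_plus_minus hA hB.isHermitian k i j
  have hK : 2 * (reDiag B i + reDiag B j) * reDiag A k ≤ 4 * (weight A * weight B) := by
    have h1 := mul_le_mul (reDiag_le_weight hB i) (reDiag_le_weight hA k) (reDiag_nonneg hA k)
      (weight_nonneg hB)
    have h2 := mul_le_mul (reDiag_le_weight hB j) (reDiag_le_weight hA k) (reDiag_nonneg hA k)
      (weight_nonneg hB)
    linarith
  rw [← hs, ← ht, ← h.sum_eq] at hadd hpm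
  have hM : (∑ r, E r).PosSemidef := Matrix.posSemidef_sum _ fun r _ => hE r
  have h1 := reForm_self_nonneg hM (v s)
  have h2 := reForm_self_nonneg hM (v t)
  have : Nonempty S := ⟨s⟩
  refine le_of_gap (by exact_mod_cast Fintype.card_pos) hc hη
    (mul_nonneg (weight_nonneg hA) (weight_nonneg hB)) (errorWeight_nonneg hE) ?_
    (reForm_sq_le_errorWeight hE hst (by linarith) (by linarith))
  rw [hpm, abs_mul, abs_of_nonneg (reDiag_nonneg hA k)]
  calc η * c * (weight A * weight B) = (η * weight B) * (c * weight A) := by ring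
    _ ≤ _ := mul_le_mul hgap (hA' k) (mul_nonneg hc (weight_nonneg hA)) (abs_nonneg _)

/-- A product operator that is balanced on both sides cannot be split with small error. -/
theorem Splits.le_errorWeight (h : Splits A B E) (hc : 0 ≤ c) (hη : 0 ≤ η) (hη1 : η ≤ 1)
    (ha : a * c + a ^ 2 * η < 1) (hb : b * c + b ^ 2 * η < 1)
    (hvA : ∀ i j : Fin a, (j : ℕ) = i + 1 → ∃ k s t, IsHorizontalPair v i j k s t)
    (hvB : ∀ i j : Fin b, (j : ℕ) = i + 1 → ∃ k s t, IsVerticalPair v k i j s t)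
    (hv : ∀ r, ∃ k i j s t, IsVerticalPair v k i j s t ∧ r ≠ s ∧ r ≠ t)
    (hA' : Balanced c A) (hB' : Balanced c B) :
    (c ^ 2 * η ^ 2) / (4 * (Fintype.card S : ℝ) ^ 2) * (weight A * weight B) ≤ errorWeight v E := by
  classical
  induction h with
  | guess A B hA hB r =>
    -- The guess `r` is wrong for both states of this pair. By balance their forms add up to at
    -- least `4 c²` times the product of the traces, more than the claim needs.
    obtain ⟨k, i, j, s, t, ⟨hst, hs, ht⟩, hrs, hrt⟩ := hv r
    have hadd := reForm_vertical_add hA hB.isHermitian k i j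
    rw [← hs, ← ht] at hadd
    have hwA := weight_nonneg hA
    have hwB := weight_nonneg hB
    have hE := (Splits.guess A B hA hB r).posSemidef.2.2
    have e1 := reForm_le_errorWeight (v := v) hE hrs
    have e2 := reForm_le_errorWeight (v := v) hE hrt
    simp only [if_true] at e1 e2
    have p1 := mul_le_mul (hB' i) (hA' k) (mul_nonneg hc hwA) (reDiag_nonneg hB i)
    have p2 := mul_le_mul (hB' j) (hA' k) (mul_nonneg hc hwA) (reDiag_nonneg hB j)
    have hτ : 0 ≤ weight A * weight B := mul_nonneg hwA hwB
    have hcard : (1 : ℝ) ≤ Fintype.card S := by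
      have : Nonempty S := ⟨r⟩
      exact_mod_cast Fintype.card_pos
    have hε : (c ^ 2 * η ^ 2) / (4 * (Fintype.card S : ℝ) ^ 2) ≤ c ^ 2 := by
      rw [div_le_iff₀ (by positivity)]
      have : η ^ 2 ≤ 4 * (Fintype.card S : ℝ) ^ 2 := by nlinarith
      exact mul_le_mul_of_nonneg_left this (sq_nonneg c)
    have h3 := mul_le_mul_of_nonneg_right hε hτ
    nlinarith
  | alice A B hB E h ih =>
    rw [weight_sum, errorWeight_sum, Finset.sum_mul, Finset.mul_sum]
    refine Finset.sum_le_sum fun i _ => ?_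
    -- Either the child is still balanced and induction applies, or balance is lost exactly here,
    -- with Bob's factor unchanged and still balanced.
    by_cases hi : Balanced c (A i)
    · exact ih i hi hB'
    · exact (h i).le_errorWeight_of_not_balanced_left hc hη ha hvA hi hB'
  | bob A B hA E h ih =>
    rw [weight_sum, errorWeight_sum, Finset.mul_sum, Finset.mul_sum]
    refine Finset.sum_le_sum fun i _ => ?_
    by_cases hi : Balanced c (B i)
    · exact ih i hA' hi
    · exact (h i).le_errorWeight_of_not_balanced_right hc hη hb hvB hA' hi

end Bound

/-! ### From protocols to splittings. -/

/-- The effect in the Heisenberg picture of a protocol that is run after local operations with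
Kraus operators `K` and `L`. -/
theorem Protocol.exists_splits {S : Type} {a' b' : ℕ} (Q : Protocol S a' b') {a b : ℕ}
    {ι κ : Type} [Fintype ι] [Fintype κ] (K : ι → Matrix (Fin a') (Fin a) ℂ)
    (L : κ → Matrix (Fin b') (Fin b) ℂ) :
    ∃ E : S → Operator a b, Splits (∑ k, (K k)ᴴ * K k) (∑ l, (L l)ᴴ * L l) E ∧
      ∀ ρ s, Q.prob (∑ k, ∑ l, (K k ⊗ₖ L l) * ρ * (K k ⊗ₖ L l)ᴴ) s = (E s * ρ).trace.re := by
  induction Q generalizing ι κ with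
  | @guess a' b' s =>
    refine ⟨_, .guess _ _
      (Matrix.posSemidef_sum _ fun k _ => Matrix.posSemidef_conjTranspose_mul_self _)
      (Matrix.posSemidef_sum _ fun k _ => Matrix.posSemidef_conjTranspose_mul_self _) s, ?_⟩
    intro ρ t
    by_cases hst : t = s
    · subst hst
      simp only [Protocol.prob, if_true]
      congr 1
      have e : (∑ k, (K k)ᴴ * K k) ⊗ₖ (∑ l, (L l)ᴴ * L l)
          = ∑ k, ∑ l, (K k ⊗ₖ L l)ᴴ * (K k ⊗ₖ L l) := by
        simp only [Matrix.conjTranspose_kronecker, ← Matrix.mul_kronecker_mul]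
        ext p q
        simp [Matrix.sum_apply, Finset.sum_mul_sum]
      rw [e]
      simp only [Finset.sum_mul, Matrix.trace_sum]
      refine Finset.sum_congr rfl fun k _ => Finset.sum_congr rfl fun l _ => ?_
      rw [Matrix.trace_mul_comm, Matrix.mul_assoc]
    · simp [Protocol.prob, hst, Ne.symm hst]
  | @alice a' b' I next ih =>
    -- The Kraus operators of outcome `i` are composed with those already applied. All effects thus
    -- live on the original space although the local dimensions change.
    choose E hE hprob using fun i =>
      ih i (fun p : ι × Fin (I.rank i) => I.op i p.2 * K p.1) L
    refine ⟨fun s => ∑ i, E i s, ?_, ?_⟩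
    · have h := Splits.alice _ _ (Matrix.posSemidef_sum _ fun l _ =>
        Matrix.posSemidef_conjTranspose_mul_self (L l)) E hE
      convert h using 1
      simp only [Fintype.sum_prod_type, Matrix.conjTranspose_mul]
      rw [Finset.sum_comm]
      refine Finset.sum_congr rfl fun k _ => ?_
      calc (K k)ᴴ * K k = (K k)ᴴ * (∑ i, ∑ j, (I.op i j)ᴴ * I.op i j) * K k := by
            rw [I.complete, Matrix.mul_one]
        _ = _ := by simp only [Matrix.mul_sum, Matrix.sum_mul, Matrix.mul_assoc]
    · intro ρ s
      simp only [Protocol.prob, Finset.sum_mul, Matrix.trace_sum, Complex.re_sum]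
      refine Finset.sum_congr rfl fun i _ => ?_
      rw [← hprob i]
      congr 1
      simp only [Instrument.onAlice, Matrix.mul_sum, Matrix.sum_mul, Fintype.sum_prod_type]
      rw [Finset.sum_comm]
      refine Finset.sum_congr rfl fun k _ => ?_
      refine Finset.sum_congr rfl fun j _ => Finset.sum_congr rfl fun l _ => ?_
      have e : (I.op i j * K k) ⊗ₖ L l = (I.op i j ⊗ₖ (1 : Matrix (Fin b') (Fin b') ℂ)) *
          (K k ⊗ₖ L l) := by rw [← Matrix.mul_kronecker_mul, Matrix.one_mul]
      rw [e, Matrix.conjTranspose_mul]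
      simp only [Matrix.mul_assoc]
  | @bob a' b' I next ih =>
    choose E hE hprob using fun i =>
      ih i K (fun p : κ × Fin (I.rank i) => I.op i p.2 * L p.1)
    refine ⟨fun s => ∑ i, E i s, ?_, ?_⟩
    · have h := Splits.bob _ _ (Matrix.posSemidef_sum _ fun k _ =>
        Matrix.posSemidef_conjTranspose_mul_self (K k)) E hE
      convert h using 1
      simp only [Fintype.sum_prod_type, Matrix.conjTranspose_mul]
      rw [Finset.sum_comm]
      refine Finset.sum_congr rfl fun l _ => ?_
      calc (L l)ᴴ * L l = (L l)ᴴ * (∑ i, ∑ j, (I.op i j)ᴴ * I.op i j) * L l := by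
            rw [I.complete, Matrix.mul_one]
        _ = _ := by simp only [Matrix.mul_sum, Matrix.sum_mul, Matrix.mul_assoc]
    · intro ρ s
      simp only [Protocol.prob, Finset.sum_mul, Matrix.trace_sum, Complex.re_sum]
      refine Finset.sum_congr rfl fun i _ => ?_
      rw [← hprob i]
      congr 1
      simp only [Instrument.onBob, Matrix.mul_sum, Matrix.sum_mul, Fintype.sum_prod_type]
      rw [Finset.sum_comm]
      refine Finset.sum_congr rfl fun k _ => ?_
      rw [Finset.sum_comm]
      refine Finset.sum_congr rfl fun l _ => Finset.sum_congr rfl fun j _ => ?_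
      have e : K k ⊗ₖ (I.op i j * L l) = ((1 : Matrix (Fin a') (Fin a') ℂ) ⊗ₖ I.op i j) *
          (K k ⊗ₖ L l) := by rw [← Matrix.mul_kronecker_mul, Matrix.one_mul]
      rw [e, Matrix.conjTranspose_mul]
      simp only [Matrix.mul_assoc]

theorem Protocol.exists_splits_one {S : Type} {a b : ℕ} (Q : Protocol S a b) :
    ∃ E : S → Operator a b, Splits 1 1 E ∧ ∀ ρ s, Q.prob ρ s = (E s * ρ).trace.re := by
  obtain ⟨E, hE, h⟩ := Q.exists_splits (a := a) (b := b) (fun _ : Unit => 1) (fun _ : Unit => 1)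
  exact ⟨E, by simpa using hE, fun ρ s => by simpa using h ρ s⟩

/-! ### Impossibility in the limit of infinitely many rounds. -/

theorem star_dotProduct_self_eq {a b : ℕ} (v : Vec a b) :
    star v ⬝ᵥ v = ((reForm 1 v v : ℝ) : ℂ) := by
  rw [reForm, Matrix.one_mulVec]
  exact Complex.ext rfl (Complex.nonneg_iff.mp (dotProduct_star_self_nonneg v)).2.symm

theorem trace_mul_density {a b : ℕ} (M : Operator a b) (v : Vec a b) :
    (M * density v).trace.re = reForm M v v / reForm 1 v v := by
  rw [density, Matrix.mul_smul, Matrix.trace_smul, Matrix.mul_vecMulVec, Matrix.trace_vecMulVec,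
    star_dotProduct_self_eq,
    dotProduct_comm, ← Complex.ofReal_inv, smul_eq_mul, Complex.re_ofReal_mul, ← reForm]
  ring

theorem weight_one (a : ℕ) : weight (1 : Matrix (Fin a) (Fin a) ℂ) = a := by
  simp [weight, reDiag]

/-- A family of vectors cannot be perfectly distinguished if consecutive basis vectors of either
party are linked by a pair `(|i⟩ ± |i+1⟩)|k⟩`, respectively `|k⟩(|i⟩ ± |i+1⟩)`, and no guess
belongs to all pairs. -/
theorem not_perfectlyDistinguishable {a b : ℕ} (ha : 0 < a) (hb : 0 < b) {V : Set (Vec a b)}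
    (hfin : V.Finite) (h0 : ∀ v ∈ V, v ≠ 0)
    (hvA : ∀ i j : Fin a, (j : ℕ) = i + 1 →
      ∃ k s t, IsHorizontalPair (Subtype.val : V → Vec a b) i j k s t)
    (hvB : ∀ i j : Fin b, (j : ℕ) = i + 1 →
      ∃ k s t, IsVerticalPair (Subtype.val : V → Vec a b) k i j s t)
    (hv : ∀ r : V, ∃ k i j s t,
      IsVerticalPair (Subtype.val : V → Vec a b) k i j s t ∧ r ≠ s ∧ r ≠ t)
    (hne : V.Nonempty) : ¬ PerfectlyDistinguishable V := by
  rintro ⟨P, -, hP⟩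
  have : Fintype V := hfin.fintype
  have : Nonempty V := hne.to_subtype
  choose E hE hprob using fun r => (P r).exists_splits_one
  have ha' : (1 : ℝ) ≤ a := by exact_mod_cast ha
  have hb' : (1 : ℝ) ≤ b := by exact_mod_cast hb
  -- This value serves as both `c` and `η`: `a + a² ≤ 2 a² < 2 (a + b)²` gives the gap condition,
  -- and `c a ≤ 1` makes the identity balanced. The same holds for `b`.
  set c : ℝ := 1 / (2 * (a + b) ^ 2) with hc
  have hc0 : 0 < c := by positivity
  have hcmul : c * (2 * (a + b) ^ 2) = 1 := by rw [hc]; field_simp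
  have hc1 : c ≤ 1 := by nlinarith
  have small : ∀ x y : ℝ, 1 ≤ x → 1 ≤ y → c * (2 * (x + y) ^ 2) = 1 →
      x * c + x ^ 2 * c < 1 ∧ c * x ≤ 1 := by
    intro x y hx hy h
    constructor <;> nlinarith [mul_pos hc0 (by positivity : 0 < x * y),
      mul_pos hc0 (by positivity : 0 < x ^ 2), mul_pos hc0 (by positivity : 0 < y ^ 2),
      mul_nonneg hc0.le (by nlinarith : 0 ≤ x ^ 2 - x)]
  obtain ⟨sa, ba⟩ := small a b ha' hb' hcmul
  obtain ⟨sb, bb⟩ := small b a hb' ha' (by rw [add_comm]; exact hcmul)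
  have bal : ∀ d : ℕ, c * d ≤ 1 → Balanced c (1 : Matrix (Fin d) (Fin d) ℂ) := by
    intro d hd i
    rw [weight_one]
    simpa [reDiag] using hd
  have hbound := fun r => (hE r).le_errorWeight hc0.le hc0.le hc1 sa sb hvA hvB hv
    (bal a ba) (bal b bb)
  have herr : ∀ r, errorWeight (Subtype.val : V → Vec a b) (E r)
      = ∑ t : V, reForm 1 t.1 t.1 * (1 - (P r).prob (density t.1) t) := by
    intro r
    rw [errorWeight_eq, (hE r).sum_eq, Matrix.one_kronecker_one]
    refine Finset.sum_congr rfl fun t _ => ?_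
    have hpos : reForm 1 t.1 t.1 ≠ 0 := by
      intro hzero
      have h := star_dotProduct_self_eq t.1
      rw [hzero, Complex.ofReal_zero] at h
      exact h0 t.1 t.2 (dotProduct_star_self_eq_zero.mp h)
    rw [hprob, trace_mul_density]
    field_simp
  have hlim : Filter.Tendsto (fun r => errorWeight (Subtype.val : V → Vec a b) (E r)) Filter.atTop
      (nhds 0) := by
    simp only [herr]
    have : (0 : ℝ) = ∑ t : V, reForm 1 t.1 t.1 * (1 - 1) := by simp
    rw [this]
    exact tendsto_finsetSum _ fun t _ => ((hP t).const_sub 1).const_mul _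
  -- The lower bound is the same for every stage `r`, so it passes to the limit `0`.
  have hle := ge_of_tendsto' hlim hbound
  rw [weight_one, weight_one] at hle
  have hcard : (0 : ℝ) < Fintype.card V := by exact_mod_cast Fintype.card_pos
  have : 0 < c ^ 2 * c ^ 2 / (4 * (Fintype.card V : ℝ) ^ 2) * (a * b) := by positivity
  linarith

/-! ### The domino states of the theorem. -/

/-- The vector `|p⟩ + |p+1⟩`, or `|p⟩ - |p+1⟩` if the flag is set. -/
def domino (a p : ℕ) (s : Bool) : Fin a → ℂ :=
  bif s then ket a p - ket a (p + 1) else ket a p + ket a (p + 1)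

/-- The index type of the family `dominoState`. -/
abbrev DominoIndex (d₁ d₂ : ℕ) : Type := ((Fin d₂ ⊕ Fin d₁) ⊕ (Fin d₂ ⊕ Fin d₁)) × Bool

/-- The vectors of `states`, as a family. -/
def dominoState (m n d₁ d₂ : ℕ) : DominoIndex d₁ d₂ → Vec m n
  | (.inl (.inl δ), s) => tensor (ket m 0) (domino n (2 * δ) s)
  | (.inl (.inr σ), s) => tensor (domino m (2 * σ) s) (ket n (n - 1))
  | (.inr (.inl δ), s) => tensor (ket m (m - 1)) (domino n (2 * δ + 1) s)
  | (.inr (.inr σ), s) => tensor (domino m (2 * σ + 1) s) (ket n 0)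

theorem range_dominoState (m n d₁ d₂ : ℕ) :
    Set.range (dominoState m n d₁ d₂) = states m n d₁ d₂ := by
  ext v
  constructor
  · rintro ⟨⟨(δ | σ) | (δ | σ), s⟩, rfl⟩
    · exact .inl <| .inl <| .inl ⟨δ, δ.2, by cases s <;> simp [dominoState, domino]⟩
    · exact .inl <| .inl <| .inr ⟨σ, σ.2, by cases s <;> simp [dominoState, domino]⟩
    · exact .inl <| .inr ⟨δ, δ.2, by cases s <;> simp [dominoState, domino]⟩
    · exact .inr ⟨σ, σ.2, by cases s <;> simp [dominoState, domino]⟩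
  · rintro (((⟨δ, h, rfl | rfl⟩ | ⟨σ, h, rfl | rfl⟩) | ⟨δ, h, rfl | rfl⟩) | ⟨σ, h, rfl | rfl⟩)
    · exact ⟨(.inl (.inl ⟨δ, h⟩), false), rfl⟩
    · exact ⟨(.inl (.inl ⟨δ, h⟩), true), rfl⟩
    · exact ⟨(.inl (.inr ⟨σ, h⟩), false), rfl⟩
    · exact ⟨(.inl (.inr ⟨σ, h⟩), true), rfl⟩
    · exact ⟨(.inr (.inl ⟨δ, h⟩), false), rfl⟩
    · exact ⟨(.inr (.inl ⟨δ, h⟩), true), rfl⟩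
    · exact ⟨(.inr (.inr ⟨σ, h⟩), false), rfl⟩
    · exact ⟨(.inr (.inr ⟨σ, h⟩), true), rfl⟩

theorem ket_ne_zero {a p : ℕ} (hp : p < a) : ket a p ≠ 0 := fun h => by
  simpa [ket] using congrFun h ⟨p, hp⟩

theorem domino_ne_zero {a p : ℕ} (hp : p < a) (s : Bool) : domino a p s ≠ 0 := fun h => by
  cases s <;> simpa [ket, domino] using congrFun h ⟨p, hp⟩

theorem tensor_ne_zero {a b : ℕ} {x : Fin a → ℂ} {y : Fin b → ℂ} (hx : x ≠ 0) (hy : y ≠ 0) :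
    tensor x y ≠ 0 := by
  obtain ⟨i, hi⟩ := Function.ne_iff.mp hx
  obtain ⟨j, hj⟩ := Function.ne_iff.mp hy
  exact fun h => mul_ne_zero hi hj (congrFun h (i, j))

theorem eq_of_ket_ne_zero {a p : ℕ} {k : Fin a} (h : ket a p k ≠ 0) : (k : ℕ) = p := by
  by_contra hk
  simp [ket, hk] at h

theorem eq_or_of_domino_ne_zero {a p : ℕ} {s : Bool} {k : Fin a} (h : domino a p s k ≠ 0) :
    (k : ℕ) = p ∨ (k : ℕ) = p + 1 := by
  by_contra! hk
  cases s <;> simp [ket, domino, hk] at h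

theorem domino_orthogonal {a p : ℕ} (hp : p + 1 < a) {s t : Bool} (hst : s ≠ t) :
    star (domino a p s) ⬝ᵥ domino a p t = 0 := by
  have h := star_ket_dotProduct (1 : Matrix (Fin a) (Fin a) ℂ)
  simp only [Matrix.one_mulVec] at h
  have h00 := h ⟨p, by omega⟩ ⟨p, by omega⟩
  have h01 := h ⟨p, by omega⟩ ⟨p + 1, hp⟩
  have h10 := h ⟨p + 1, hp⟩ ⟨p, by omega⟩
  have h11 := h ⟨p + 1, hp⟩ ⟨p + 1, hp⟩
  simp at h00 h01 h10 h11
  cases s <;> cases t <;> simp_all [domino]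

section States

variable {m n d₁ d₂ : ℕ}

theorem dominoState_ne_zero (hm : m = 2 * d₁ + 1) (hn : n = 2 * d₂ + 1) (i : DominoIndex d₁ d₂) :
    dominoState m n d₁ d₂ i ≠ 0 := by
  obtain ⟨(δ | σ) | (δ | σ), s⟩ := i
  · exact tensor_ne_zero (ket_ne_zero (by omega)) (domino_ne_zero (by omega) s)
  · exact tensor_ne_zero (domino_ne_zero (by omega) s) (ket_ne_zero (by omega))
  · exact tensor_ne_zero (ket_ne_zero (by omega)) (domino_ne_zero (by omega) s)
  · exact tensor_ne_zero (domino_ne_zero (by omega) s) (ket_ne_zero (by omega))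

/-- Different dominoes cover disjoint sets of cells. -/
theorem dominoState_disjoint (hm : m = 2 * d₁ + 1) (hm3 : 3 ≤ m) (hn : n = 2 * d₂ + 1) (hn3 : 3 ≤ n)
    {i j : DominoIndex d₁ d₂} {p : Fin m × Fin n} (hi : dominoState m n d₁ d₂ i p ≠ 0)
    (hj : dominoState m n d₁ d₂ j p ≠ 0) : i.1 = j.1 := by
  obtain ⟨(δ | σ) | (δ | σ), s⟩ := i <;> obtain ⟨(δ' | σ') | (δ' | σ'), t⟩ := j <;>
    simp only [dominoState, tensor, mul_ne_zero_iff] at hi hj <;>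
    obtain ⟨hi₁, hi₂⟩ := hi <;> obtain ⟨hj₁, hj₂⟩ := hj <;>
    first
      | replace hi₁ := eq_of_ket_ne_zero hi₁
        replace hi₂ := eq_or_of_domino_ne_zero hi₂
      | replace hi₁ := eq_or_of_domino_ne_zero hi₁
        replace hi₂ := eq_of_ket_ne_zero hi₂
  all_goals
    first
      | replace hj₁ := eq_of_ket_ne_zero hj₁
        replace hj₂ := eq_or_of_domino_ne_zero hj₂
      | replace hj₁ := eq_or_of_domino_ne_zero hj₁
        replace hj₂ := eq_of_ket_ne_zero hj₂
  -- Two different sides can share only a corner. Row `0` stops at column `n-2`, column `n-1` at row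
  -- `m-2`, row `m-1` starts at column `1` and column `0` at row `1`, so each corner is covered by
  -- one side only.
  all_goals
    first
      | omega
      | simp only [Sum.inl.injEq, Sum.inr.injEq, Fin.ext_iff]; omega

theorem dominoState_orthogonal (hm : m = 2 * d₁ + 1) (hm3 : 3 ≤ m)
    (hn : n = 2 * d₂ + 1) (hn3 : 3 ≤ n)
    {i j : DominoIndex d₁ d₂} (hij : i ≠ j) :
    star (dominoState m n d₁ d₂ i) ⬝ᵥ dominoState m n d₁ d₂ j = 0 := by
  by_cases h : i.1 = j.1
  · obtain ⟨i, s⟩ := i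
    obtain ⟨j, t⟩ := j
    obtain rfl : i = j := h
    have hst : s ≠ t := fun h => hij (by rw [h])
    obtain (δ | σ) | (δ | σ) := i <;>
      simp only [dominoState, star_tensor, tensor_dotProduct] <;>
      rw [domino_orthogonal ?_ hst] <;> first | omega | simp
  · refine Finset.sum_eq_zero fun p _ => ?_
    by_contra hp
    rw [← ne_eq, mul_ne_zero_iff, Pi.star_apply, star_ne_zero] at hp
    exact h (dominoState_disjoint hm hm3 hn hn3 hp.1 hp.2)

/-- If two indices gave the same vector, it would be orthogonal to itself, hence zero. -/
theorem dominoState_injective (hm : m = 2 * d₁ + 1) (hm3 : 3 ≤ m)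
    (hn : n = 2 * d₂ + 1) (hn3 : 3 ≤ n) :
    Function.Injective (dominoState m n d₁ d₂) := by
  intro i j hij
  by_contra hne
  have h := dominoState_orthogonal hm hm3 hn hn3 hne
  rw [← hij] at h
  exact dominoState_ne_zero hm hn i (dotProduct_star_self_eq_zero.mp h)

theorem isOPS_states (hm : m = 2 * d₁ + 1) (hm3 : 3 ≤ m)
    (hn : n = 2 * d₂ + 1) (hn3 : 3 ≤ n) : IsOPS (states m n d₁ d₂) := by
  rw [← range_dominoState]
  constructor
  · rintro _ ⟨i, rfl⟩
    refine ⟨dominoState_ne_zero hm hn i, ?_⟩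
    obtain ⟨(δ | σ) | (δ | σ), s⟩ := i <;> exact ⟨_, _, rfl⟩
  · rintro _ ⟨i, rfl⟩ _ ⟨j, rfl⟩ hij
    exact dominoState_orthogonal hm hm3 hn hn3 fun h => hij (by rw [h])

theorem ncard_states (hm : m = 2 * d₁ + 1) (hm3 : 3 ≤ m) (hn : n = 2 * d₂ + 1) (hn3 : 3 ≤ n) :
    (states m n d₁ d₂).ncard = 2 * (m + n) - 4 := by
  rw [← range_dominoState, Set.ncard_range_of_injective (dominoState_injective hm hm3 hn hn3)]
  simp [Nat.card_eq_fintype_card]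
  omega

/-- The index of a vector of `states`, as an element of the set. -/
def dominoElement (m n : ℕ) {d₁ d₂ : ℕ} (i : DominoIndex d₁ d₂) : states m n d₁ d₂ :=
  ⟨dominoState m n d₁ d₂ i, range_dominoState m n d₁ d₂ ▸ ⟨i, rfl⟩⟩

theorem dominoElement_ne (hm : m = 2 * d₁ + 1) (hm3 : 3 ≤ m)
    (hn : n = 2 * d₂ + 1) (hn3 : 3 ≤ n) {i j : DominoIndex d₁ d₂}
    (hij : i ≠ j) : dominoElement m n i ≠ dominoElement m n j :=
  fun h => hij (dominoState_injective hm hm3 hn hn3 (congrArg Subtype.val h))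

theorem exists_horizontalPair (hm : m = 2 * d₁ + 1) (hm3 : 3 ≤ m)
    (hn : n = 2 * d₂ + 1) (hn3 : 3 ≤ n) (i j : Fin m)
    (hij : (j : ℕ) = i + 1) :
    ∃ k s t, IsHorizontalPair (Subtype.val : states m n d₁ d₂ → Vec m n) i j k s t := by
  -- Even `i` are linked to `i + 1` in column `n-1`, odd `i` in column `0`.
  rcases Nat.even_or_odd' i with ⟨σ, h | h⟩
  · refine ⟨⟨n - 1, by omega⟩, dominoElement m n (.inl (.inr ⟨σ, by omega⟩), false),
      dominoElement m n (.inl (.inr ⟨σ, by omega⟩), true),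
      dominoElement_ne hm hm3 hn hn3 (by simp), ?_⟩
    simp [dominoElement, dominoState, domino, hij, h]
  · refine ⟨⟨0, by omega⟩, dominoElement m n (.inr (.inr ⟨σ, by omega⟩), false),
      dominoElement m n (.inr (.inr ⟨σ, by omega⟩), true),
      dominoElement_ne hm hm3 hn hn3 (by simp), ?_⟩
    simp [dominoElement, dominoState, domino, hij, h]

theorem isVerticalPair_zero (hm : m = 2 * d₁ + 1) (hm3 : 3 ≤ m)
    (hn : n = 2 * d₂ + 1) (hn3 : 3 ≤ n) (δ : Fin d₂) :
    IsVerticalPair (Subtype.val : states m n d₁ d₂ → Vec m n) ⟨0, by omega⟩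
      ⟨2 * δ, by omega⟩ ⟨2 * δ + 1, by omega⟩
      (dominoElement m n (.inl (.inl δ), false)) (dominoElement m n (.inl (.inl δ), true)) :=
  ⟨dominoElement_ne hm hm3 hn hn3 (by simp), rfl, rfl⟩

theorem isVerticalPair_last (hm : m = 2 * d₁ + 1) (hm3 : 3 ≤ m)
    (hn : n = 2 * d₂ + 1) (hn3 : 3 ≤ n) (δ : Fin d₂) :
    IsVerticalPair (Subtype.val : states m n d₁ d₂ → Vec m n) ⟨m - 1, by omega⟩
      ⟨2 * δ + 1, by omega⟩ ⟨2 * δ + 2, by omega⟩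
      (dominoElement m n (.inr (.inl δ), false)) (dominoElement m n (.inr (.inl δ), true)) :=
  ⟨dominoElement_ne hm hm3 hn hn3 (by simp), rfl, rfl⟩

theorem exists_verticalPair (hm : m = 2 * d₁ + 1) (hm3 : 3 ≤ m)
    (hn : n = 2 * d₂ + 1) (hn3 : 3 ≤ n) (i j : Fin n)
    (hij : (j : ℕ) = i + 1) :
    ∃ k s t, IsVerticalPair (Subtype.val : states m n d₁ d₂ → Vec m n) k i j s t := by
  rcases Nat.even_or_odd' i with ⟨δ, h | h⟩
  · obtain ⟨i, hi⟩ := i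
    obtain ⟨j, hj⟩ := j
    obtain rfl : i = 2 * δ := h
    obtain rfl : j = 2 * δ + 1 := hij
    exact ⟨_, _, _, isVerticalPair_zero hm hm3 hn hn3 ⟨δ, by omega⟩⟩
  · obtain ⟨i, hi⟩ := i
    obtain ⟨j, hj⟩ := j
    obtain rfl : i = 2 * δ + 1 := h
    obtain rfl : j = 2 * δ + 2 := hij
    exact ⟨_, _, _, isVerticalPair_last hm hm3 hn hn3 ⟨δ, by omega⟩⟩

/-- Rows `0` and `m-1` each contain a pair, and these two pairs are disjoint, so `r` misses at least
one. -/
theorem exists_verticalPair_ne (hm : m = 2 * d₁ + 1) (hm3 : 3 ≤ m)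
    (hn : n = 2 * d₂ + 1) (hn3 : 3 ≤ n)
    (r : states m n d₁ d₂) :
    ∃ k i j s t, IsVerticalPair (Subtype.val : states m n d₁ d₂ → Vec m n) k i j s t ∧
      r ≠ s ∧ r ≠ t := by
  have hd₂ : 0 < d₂ := by omega
  obtain ⟨l, hl⟩ : ∃ l, dominoElement m n l = r := by
    obtain ⟨l, hl⟩ := (range_dominoState m n d₁ d₂).ge r.2
    exact ⟨l, Subtype.ext hl⟩
  subst hl
  by_cases h : l.1 = .inl (.inl ⟨0, hd₂⟩)
  · refine ⟨_, _, _, _, _, isVerticalPair_last hm hm3 hn hn3 ⟨0, hd₂⟩, ?_, ?_⟩ <;>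
    · refine dominoElement_ne hm hm3 hn hn3 fun h' => ?_
      rw [h'] at h
      simp at h
  · refine ⟨_, _, _, _, _, isVerticalPair_zero hm hm3 hn hn3 ⟨0, hd₂⟩, ?_, ?_⟩ <;>
    · refine dominoElement_ne hm hm3 hn hn3 fun h' => ?_
      rw [h'] at h
      simp at h

end States

end LOCC

theorem theorem4 (m n d₁ d₂ : ℕ) (hm : m = 2 * d₁ + 1) (hm3 : 3 ≤ m)
    (hn : n = 2 * d₂ + 1) (hn3 : 3 ≤ n) :
    LOCC.IsOPS (LOCC.states m n d₁ d₂) ∧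
    (LOCC.states m n d₁ d₂).ncard = 2 * (m + n) - 4 ∧
    ¬ LOCC.PerfectlyDistinguishable (LOCC.states m n d₁ d₂) := by
  have hcard := LOCC.ncard_states hm hm3 hn hn3
  refine ⟨LOCC.isOPS_states hm hm3 hn hn3, hcard, ?_⟩
  exact LOCC.not_perfectlyDistinguishable (by omega) (by omega)
    -- An infinite set has `ncard` equal to `0`, so the count `2 * (m + n) - 4 ≥ 8` yields
    -- finiteness, and below also nonemptiness.
    (Set.finite_of_ncard_ne_zero (by omega))
    (fun v hv => ((LOCC.isOPS_states hm hm3 hn hn3).1 v hv).1)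
    (LOCC.exists_horizontalPair hm hm3 hn hn3) (LOCC.exists_verticalPair hm hm3 hn hn3)
    (LOCC.exists_verticalPair_ne hm hm3 hn hn3) (Set.nonempty_of_ncard_ne_zero (by omega))
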